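/- \textbf{Counting logic and pebble game.} For a relational vocabulary, $C^k$ is the infinitary logic with variables $x_1,\dots,x_k$ built from atomic formulas (including equality) by negation, arbitrary (possibly infinite) conjunctions, and the counting quantifiers $\exists^{\ge n}x_i$. Structures $\mathbb A,\mathbb B$ are $C^k$-equivalent, $\mathbb A\equiv_{C^k}\mathbb B$, if they satisfy the same sentences of $C^k$. In the $k$-pebble bijective game on $\mathbb A,\mathbb B$, in each round Spoiler picks up one of $k$ pebble pairs, Duplicator gives a bijection $f$ from the universe of $\mathbb A$ to that of $\mathbb B$ with $f(a)=b$ for each remaining pebble pair placed on $(a,b)$, and Spoiler places the pair on some $(a,f(a))$. Spoiler wins if at some point the map between correspondingly pebbled elements is not a partial isomorphism; Duplicator wins if this never happens. \textbf{Unique games.} A group unique games instance $U$ with finite Abelian group $A$ is a set of variables together with a set of constraints of the form $x-y=z$ with $x,y$ variables and $z\in A$. It is regarded as a relational structure whose universe is the set of variables, with one binary relation symbol $P_\pi$ for every permutation $\pi$ of $A$: $(x,y)\in P_\pi$ if and only if for some $z\in A$ the equation $y-x=z$ is a constraint and $\pi(a)=z+a$ for all $a$. The label-lifted instance $\mathcal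 G(U)$ has variables $x_v^g$, for $x_v$ a variable of $U$ and $g\in A$, and for every constraint $x_{v_1}-x_{v_2}=z$ of $U$ and all $g_1,g_2\in A$ the constraint $(x_{v_1}^{g_1}-g_1)-(x_{v_2}^{g_2}-g_2)=z$. \textbf{Construction.} Let $0<\varepsilon<\frac12$, $\delta>0$, let $\ell\ge 1$ and $k\ge 0$ be integers, and put $d=2^\ell+1$, \[\gamma=1-\frac{\frac1{2^{2\ell-1}+2^{\ell-1}}+\frac{\delta}{2^\ell}}{\frac1{2^{2\ell-1}+2^{\ell-1}}+\delta},\qquad m=\left\lceil\frac1\delta+\Bigl(\frac2{\delta d}+1\Bigr)\ell-\frac2{\delta d}\log_2\varepsilon\right\rceil,\qquad r=\left\lceil\frac{2^{m\ell+1}(d^{m-\ell}-1)}{\gamma\varepsilon}\right\rceil+1.\] Let $\widetilde H$ be a finite $d$-regular simple graph of girth at least $(k+1)^2r$. For every edge $\{v_1,v_2\}$ of $\widetilde H$ let $b(v_1,v_2)=b(v_2,v_1)\in\mathbb F_2^m$ be any vector and $Z(v_1,v_2)=Z(v_2,v_1)\subseteq\mathbb F_2^m$ any $\ell$-dimensional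 subspace. An edge $e$ of $\widetilde H$ is good if for all paths $(v_0,\dots,v_r)$ of length $r$ in $\widetilde H$ (paths do not repeat edges) with $e=\{v_0,v_1\}$, the set $\bigcup_{i=1}^r Z(v_{i-1},v_i)$ spans $\mathbb F_2^m$. Let $H$ be the graph on $V(\widetilde H)$ whose edges are the good edges. Let $U_1$ and $U_2$ be the group unique games instances with group $\mathbb F_2^m$ and variables $x_v$, $v\in V(H)$, whose constraints are, for every edge $\{v_1,v_2\}\in E(H)$ and every $z\in Z(v_1,v_2)$, respectively \[x_{v_1}-x_{v_2}=z\quad(\text{in }U_1),\qquad x_{v_1}-x_{v_2}=z+b(v_1,v_2)\quad(\text{in }U_2).\] \textbf{Lemma.} For every such choice of $\widetilde H$, $b$ and $Z$, $\mathcal G(U_1)\equiv_{C^k}\mathcal G(U_2)$; moreover, Duplicator has a winning strategy in the $k$-pebble bijective game on $\mathcal G(U_1)$ and $\mathcal G(U_2)$. -/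

import Mathlib

universe u v w u₁ u₂

/-! ### The counting logic with `k` variables -/

/-- Formulas of the infinitary counting logic `C^k` over a relational vocabulary: the variables are
indexed by `Fin k`, conjunctions may be infinite, and `countEx n i φ` is the counting quantifier
"there are at least `n` elements `xᵢ` such that `φ`". Disjunctions, `∃` and `∀` are definable. -/
inductive CFormula (L : FirstOrder.Language.{u, v}) (k : ℕ) : Type (max v (w + 1))
  | rel {n : ℕ} (R : L.Relations n) (t : Fin n → Fin k) : CFormula L k
  | eq (i j : Fin k) : CFormula L k
  | neg (φ : CFormula L k) : CFormula L k
  | conj {ι : Type w} (φ : ι → CFormula L k) : CFormula L k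
  | countEx (n : ℕ) (i : Fin k) (φ : CFormula L k) : CFormula L k

namespace CFormula

/-- The free variables of a formula. -/
def freeVars {L : FirstOrder.Language.{u, v}} {k : ℕ} : CFormula.{u, v, w} L k → Set (Fin k)
  | rel _ t => Set.range t
  | eq i j => {i, j}
  | neg φ => φ.freeVars
  | conj φ => ⋃ a, (φ a).freeVars
  | countEx _ i φ => φ.freeVars \ {i}

/-- A sentence is a formula without free variables. -/
def IsSentence {L : FirstOrder.Language.{u, v}} {k : ℕ} (φ : CFormula.{u, v, w} L k) : Prop :=
  φ.freeVars = ∅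

/-- Satisfaction of a formula in the structure `𝔸` under a partial assignment `s` of elements to
variables (atoms that mention an unassigned variable are false; this never matters for the free
variables of a formula whose free variables are all assigned). -/
def Sat {L : FirstOrder.Language.{u, v}} {k : ℕ} {M : Type u₁} (𝔸 : L.Structure M) :
    (Fin k → Option M) → CFormula.{u, v, w} L k → Prop
  | s, rel (n := n) R t =>
      ∃ x : Fin n → M, (∀ j, s (t j) = some (x j)) ∧ 𝔸.RelMap R x
  | s, eq i j => ∃ a : M, s i = some a ∧ s j = some a
  | s, neg φ => ¬ Sat 𝔸 s φ
  | s, conj φ => ∀ a, Sat 𝔸 s (φ a)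
  | s, countEx n i φ => (n : ℕ∞) ≤ {a : M | Sat 𝔸 (Function.update s i (some a)) φ}.encard

/-- `𝔸 ⊨ φ` for a sentence `φ`. -/
def Models {L : FirstOrder.Language.{u, v}} {k : ℕ} {M : Type u₁} (𝔸 : L.Structure M)
    (φ : CFormula.{u, v, w} L k) : Prop :=
  φ.Sat 𝔸 (fun _ => none)

end CFormula

/-- `C^k`-equivalence: the two structures satisfy the same sentences of `C^k`. (The universe `w`
bounds the size of the infinite conjunctions.) -/
def CkEquiv {L : FirstOrder.Language.{u, v}} (k : ℕ) {M : Type u₁} {N : Type u₂}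
    (𝔸 : L.Structure M) (𝔹 : L.Structure N) : Prop :=
  ∀ φ : CFormula.{u, v, w} L k, φ.IsSentence → (φ.Models 𝔸 ↔ φ.Models 𝔹)

/-! ### The `k`-pebble bijective game -/

/-- A position of the game: the pairs of elements on which the `k` pebble pairs lie, where `none`
means that the pair is not on the board. -/
abbrev PebblePosition (k : ℕ) (M : Type u₁) (N : Type u₂) := Fin k → Option (M × N)

/-- The pebbled elements of `𝔸` are mapped to the correspondingly pebbled elements of `𝔹` by a
partial isomorphism. -/
def IsPartialIsoAt {L : FirstOrder.Language.{u, v}} {k : ℕ} {M : Type u₁} {N : Type u₂}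
    (𝔸 : L.Structure M) (𝔹 : L.Structure N) (p : PebblePosition k M N) : Prop :=
  (∀ (i j : Fin k) (a a' : M) (b b' : N),
      p i = some (a, b) → p j = some (a', b') → (a = a' ↔ b = b')) ∧
  ∀ (n : ℕ) (R : L.Relations n) (t : Fin n → Fin k) (x : Fin n → M) (y : Fin n → N),
      (∀ j, p (t j) = some (x j, y j)) → (𝔸.RelMap R x ↔ 𝔹.RelMap R y)

/-- Duplicator has a winning strategy in the `k`-pebble bijective game on `𝔸` and `𝔹`: there is a
set `W` of positions, containing the initial one, at none of which Spoiler has won, and such that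
whichever pebble pair `i` Spoiler picks up at a position in `W`, Duplicator has a bijection `f`
compatible with the other pebble pairs such that, wherever Spoiler puts the pebbles back on some
`a` and `f a`, the new position is again in `W`. -/
def DuplicatorWins {L : FirstOrder.Language.{u, v}} (k : ℕ) {M : Type u₁} {N : Type u₂}
    (𝔸 : L.Structure M) (𝔹 : L.Structure N) : Prop :=
  ∃ W : Set (PebblePosition k M N),
    (fun _ => none) ∈ W ∧
    ∀ p ∈ W, IsPartialIsoAt 𝔸 𝔹 p ∧
      ∀ i : Fin k, ∃ f : M ≃ N,
        (∀ (j : Fin k) (a : M) (b : N), j ≠ i → p j = some (a, b) → f a = b) ∧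
        ∀ a : M, Function.update p i (some (a, f a)) ∈ W

/-! ### Unique games -/

/-- The relation symbols of the vocabulary of unique games on the label set `A`: one binary symbol
`P_π` for every permutation `π` of `A`. -/
inductive UGRel (A : Type) : ℕ → Type
  | perm (π : Equiv.Perm A) : UGRel A 2

/-- The vocabulary of unique games on the label set `A`. -/
def ugLanguage (A : Type) : FirstOrder.Language.{0, 0} where
  Functions := fun _ => Empty
  Relations := UGRel A

/-- A group unique games instance with group `A` and variable set `X`, given by its set of
constraints: `U.IsConstraint x y z` says that the equation `x - y = z` is a constraint of `U`. -/
structure GroupUniqueGame (A : Type) (X : Type u) where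
  IsConstraint : X → X → A → Prop

namespace GroupUniqueGame

variable {A : Type} [AddCommGroup A] {X : Type u}

/-- The instance as a relational structure with universe `X`: the pair `(x, y)` is in `P_π` if and
only if, for some `z`, the equation `y - x = z` is a constraint and `π` is the translation
`a ↦ z + a`. -/
@[reducible] def toStructure (U : GroupUniqueGame A X) : (ugLanguage A).Structure X where
  funMap := fun f => Empty.elim f
  RelMap := fun R => match R with
    | UGRel.perm π => fun x => ∃ z : A, U.IsConstraint (x 1) (x 0) z ∧ ∀ a : A, π a = z + a

/-- The label-lifted instance `𝒢(U)`. Its variables are the pairs `(x, g)`, written `x^g`, and for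
every constraint `x₁ - x₂ = z₀` of `U` and all `g₁, g₂` it has the constraint
`(x₁^{g₁} - g₁) - (x₂^{g₂} - g₂) = z₀`, that is, `x₁^{g₁} - x₂^{g₂} = z₀ + g₁ - g₂`. -/
def labelLift (U : GroupUniqueGame A X) : GroupUniqueGame A (X × A) where
  IsConstraint := fun x y z => ∃ z₀ : A, U.IsConstraint x.1 y.1 z₀ ∧ z = z₀ + x.2 - y.2

end GroupUniqueGame

/-! ### The construction -/

/-- The degree `d = 2^ℓ + 1`. -/
def degreeParam (ℓ : ℕ) : ℕ := 2 ^ ℓ + 1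

/-- The parameter `γ`. -/
noncomputable def gammaParam (δ : ℝ) (ℓ : ℕ) : ℝ :=
  1 - (1 / ((2 : ℝ) ^ (2 * ℓ - 1) + 2 ^ (ℓ - 1)) + δ / 2 ^ ℓ) /
      (1 / ((2 : ℝ) ^ (2 * ℓ - 1) + 2 ^ (ℓ - 1)) + δ)

/-- The dimension `m`. -/
noncomputable def dimParam (ε δ : ℝ) (ℓ : ℕ) : ℕ :=
  ⌈1 / δ + (2 / (δ * degreeParam ℓ) + 1) * ℓ - 2 / (δ * degreeParam ℓ) * Real.logb 2 ε⌉₊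

/-- The radius `r`. -/
noncomputable def radiusParam (ε δ : ℝ) (ℓ : ℕ) : ℕ :=
  ⌈(2 : ℝ) ^ (dimParam ε δ ℓ * ℓ + 1) * ((degreeParam ℓ : ℝ) ^ (dimParam ε δ ℓ - ℓ) - 1) /
      (gammaParam δ ℓ * ε)⌉₊ + 1

/-- The vector space `𝔽₂^m`. -/
abbrev F2Vec (m : ℕ) : Type := Fin m → ZMod 2

section Construction

variable {V : Type u} {m : ℕ}

/-- An edge `e` of `H` is good (for the radius `r` and the subspaces `Z`) if for every path
`(v₀, …, v_r)` of length `r` with `e = {v₀, v₁}`, the union of the subspaces along the path spans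
`𝔽₂^m`. Paths are not allowed to repeat edges. -/
def IsGoodEdge (H : SimpleGraph V) (r : ℕ) (Z : Sym2 V → Submodule (ZMod 2) (F2Vec m))
    (e : Sym2 V) : Prop :=
  e ∈ H.edgeSet ∧
    ∀ (x y : V) (p : H.Walk x y), p.IsTrail → p.length = r → p.edges.head? = some e →
      Submodule.span (ZMod 2) (⋃ f ∈ p.edges, (Z f : Set (F2Vec m))) = ⊤

/-- The graph with the same vertices whose edges are the good edges. -/
def goodGraph (H : SimpleGraph V) (r : ℕ) (Z : Sym2 V → Submodule (ZMod 2) (F2Vec m)) :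
    SimpleGraph V :=
  SimpleGraph.fromEdgeSet {e | IsGoodEdge H r Z e}

/-- The instance with the constraints `x - y = z`, for `{x, y}` an edge of `G` and
`z ∈ Z(x, y)`. -/
def linearInstance (G : SimpleGraph V) (Z : Sym2 V → Submodule (ZMod 2) (F2Vec m)) :
    GroupUniqueGame (F2Vec m) V where
  IsConstraint := fun x y c => G.Adj x y ∧ ∃ z ∈ Z s(x, y), c = z

/-- The instance with the constraints `x - y = z + b(x, y)`, for `{x, y}` an edge of `G` and
`z ∈ Z(x, y)`. -/
def shiftedInstance (G : SimpleGraph V) (Z : Sym2 V → Submodule (ZMod 2) (F2Vec m))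
    (b : Sym2 V → F2Vec m) : GroupUniqueGame (F2Vec m) V where
  IsConstraint := fun x y c => G.Adj x y ∧ ∃ z ∈ Z s(x, y), c = z + b s(x, y)

end Construction

/-! ### From the game to the logic -/

/-! It suffices to win the game, since a winning strategy preserves every formula at every position
(`DuplicatorWins.ckEquiv`). Duplicator keeps a shift `h` of the variables, answers `x^g` by `x^(g +
h x)`, and ensures that `h` respects the constraints inside the closure of the pebbled variables
under paths of length less than `2 * r`. On the pebbled variables this already gives a partial
isomorphism, because each `Z e` is invariant under translation by its own elements.

To answer a move, `h` must extend from the closure of the remaining pebbles to that closure with one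
more vertex. Two facts make this possible. Each short path added while forming a closure raises the
number of edges minus the number of vertices, so in large girth the closure is reached after few
steps and spans a forest (`restrictTo_pathClosure_isAcyclic`). In this forest, a prescribed value
propagates along a path as a coset of the sum of the spaces `Z e`, which is everything after `r`
good edges; distinct prescribed vertices are at least `2 * r` apart along the new edges, so their
demands never collide (`exists_shift_of_coset_requirements`). -/

theorem DuplicatorWins.ckEquiv {L : FirstOrder.Language.{u, v}} {k : ℕ} {M : Type u₁} {N : Type u₂}
    {𝔸 : L.Structure M} {𝔹 : L.Structure N} (hD : DuplicatorWins k 𝔸 𝔹) :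
    CkEquiv.{u, v, w} k 𝔸 𝔹 := by
  obtain ⟨W, hW0, hW⟩ := hD
  -- The induction needs free variables and all positions of `W`. Both assignments are undefined at
  -- the same variables, so the convention for unassigned variables does no harm.
  have key : ∀ φ : CFormula.{u, v, w} L k, ∀ p ∈ W,
      (φ.Sat 𝔸 (fun i => (p i).map Prod.fst) ↔ φ.Sat 𝔹 (fun i => (p i).map Prod.snd)) := by
    intro φ
    induction φ with
    | rel R t =>
      intro p hp
      have hiso := (hW p hp).1.2 _ R t
      simp only [CFormula.Sat, Option.map_eq_some_iff]
      constructor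
      · rintro ⟨x, hx, hR⟩
        choose q hq hqx using hx
        refine ⟨fun j => (q j).2, fun j => ⟨q j, hq j, rfl⟩, ?_⟩
        exact (hiso x _ fun j => by rw [hq j, ← hqx j]).1 hR
      · rintro ⟨y, hy, hR⟩
        choose q hq hqy using hy
        refine ⟨fun j => (q j).1, fun j => ⟨q j, hq j, rfl⟩, ?_⟩
        exact (hiso _ y fun j => by rw [hq j, ← hqy j]).2 hR
    | eq i j =>
      intro p hp
      have hiso := (hW p hp).1.1 i j
      simp only [CFormula.Sat, Option.map_eq_some_iff]
      constructor
      · rintro ⟨a, ⟨⟨q, q'⟩, hq, rfl⟩, ⟨⟨s, s'⟩, hs, hqs⟩⟩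
        exact ⟨q', ⟨_, hq, rfl⟩, ⟨_, hs, ((hiso _ _ _ _ hq hs).1 hqs.symm).symm⟩⟩
      · rintro ⟨a, ⟨⟨q, q'⟩, hq, rfl⟩, ⟨⟨s, s'⟩, hs, hqs⟩⟩
        exact ⟨q, ⟨_, hq, rfl⟩, ⟨_, hs, ((hiso _ _ _ _ hq hs).2 hqs.symm).symm⟩⟩
    | neg φ ih =>
      intro p hp
      simp only [CFormula.Sat, ih p hp]
    | conj φ ih =>
      intro p hp
      simp only [CFormula.Sat, ih _ p hp]
    | countEx n i φ ih =>
      intro p hp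
      obtain ⟨f, -, hf⟩ := (hW p hp).2 i
      have hiff : ∀ a : M,
          φ.Sat 𝔸 (Function.update (fun i => (p i).map Prod.fst) i (some a)) ↔
            φ.Sat 𝔹 (Function.update (fun i => (p i).map Prod.snd) i (some (f a))) := by
        intro a
        have h := ih _ (hf a)
        convert h using 2 <;>
        · funext j
          by_cases hj : j = i
          · subst hj; simp
          · simp [hj]
      -- Duplicator's bijection carries one solution set onto the other, so all counts agree.
      have hset : {b : N | φ.Sat 𝔹 (Function.update (fun i => (p i).map Prod.snd) i (some b))} =
          f '' {a : M | φ.Sat 𝔸 (Function.update (fun i => (p i).map Prod.fst) i (some a))} := by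
        ext b
        simp only [Set.mem_ofPred_eq, Set.mem_image, hiff]
        exact ⟨fun h => ⟨f.symm b, by simpa using h, by simp⟩, by rintro ⟨a, ha, rfl⟩; exact ha⟩
      simp only [CFormula.Sat, hset, f.injective.encard_image]
  intro φ _
  exact key φ _ hW0

/-! ### Finite forests -/

namespace SimpleGraph

variable {V : Type u}

/-- The start of a longest path inside `Q` works: a neighbour in `Q` off the path would lengthen it,
and a neighbour on the path can only be the second vertex, as there are no cycles. -/
theorem IsAcyclic.exists_mem_subsingleton_neighbors [Finite V] {G : SimpleGraph V}
    (hG : G.IsAcyclic) {Q : Finset V} (hQ : Q.Nonempty) :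
    ∃ v ∈ Q, ∀ u ∈ Q, ∀ w ∈ Q, G.Adj v u → G.Adj v w → u = w := by
  classical
  have := Fintype.ofFinite V
  let good : ℕ → Prop := fun n =>
    ∃ v x, ∃ p : G.Walk v x, p.IsPath ∧ (∀ y ∈ p.support, y ∈ Q) ∧ p.length = n
  obtain ⟨q, hq⟩ := hQ
  have h0 : good 0 := ⟨q, q, .nil, by simp, by simpa using hq, rfl⟩
  have hbound : ∀ n, good n → n ≤ Fintype.card V := by
    rintro n ⟨v, x, p, hp, -, rfl⟩
    exact hp.length_lt.le
  obtain ⟨v, x, p, hp, hpQ, hlen⟩ := Nat.findGreatest_spec (P := good) (Nat.zero_le _) h0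
  have hsnd : ∀ u ∈ Q, G.Adj v u → u = p.snd := by
    intro u hu hvu
    by_cases hup : u ∈ p.support
    · exact hG.eq_snd_of_adj_start hp hvu hup
    · have hg : good (p.length + 1) :=
        ⟨u, x, .cons hvu.symm p, hp.cons hup, by simpa using ⟨hu, hpQ⟩, rfl⟩
      exact absurd (hlen ▸ Nat.le_findGreatest (hbound _ hg) hg) (Nat.not_succ_le_self _)
  exact ⟨v, hpQ v p.start_mem_support, fun u hu w hw hvu hvw =>
    (hsnd u hu hvu).trans (hsnd w hw hvw).symm⟩

/-- The edges of `G` with both ends in `S`. -/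
noncomputable def edgesWithin [Fintype V] (G : SimpleGraph V) (S : Finset V) : Finset (Sym2 V) := by
  classical exact G.edgeFinset ∩ S.sym2

theorem mk_mem_edgesWithin [Fintype V] {G : SimpleGraph V} {S : Finset V} {x y : V} :
    s(x, y) ∈ G.edgesWithin S ↔ G.Adj x y ∧ x ∈ S ∧ y ∈ S := by
  classical
  simp [edgesWithin]

/-- The graph on the same vertices whose edges are the edges of `G` with both ends in `S`. -/
def restrictTo (G : SimpleGraph V) (S : Set V) : SimpleGraph V where
  Adj x y := G.Adj x y ∧ x ∈ S ∧ y ∈ S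
  symm := ⟨fun _ _ h => ⟨h.1.symm, h.2.2, h.2.1⟩⟩
  loopless := ⟨fun _ h => h.1.ne rfl⟩

theorem restrictTo_le (G : SimpleGraph V) (S : Set V) : G.restrictTo S ≤ G := fun _ _ h => h.1

/-- Deleting a leaf or an isolated vertex loses at most one edge. The sharper bound for nonempty
forests is not needed. -/
theorem card_edgesWithin_le_of_isAcyclic [Fintype V] {G : SimpleGraph V} (Q : Finset V)
    (hG : (G.restrictTo Q).IsAcyclic) : (G.edgesWithin Q).card ≤ Q.card := by
  classical
  induction Q using Finset.strongInduction with
  | H Q ih =>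
    rcases Q.eq_empty_or_nonempty with rfl | hQ
    · simp [edgesWithin]
    obtain ⟨v, hv, hleaf⟩ := hG.exists_mem_subsingleton_neighbors hQ
    have hle : G.restrictTo (Q.erase v : Finset V) ≤ G.restrictTo Q := fun x y h =>
      ⟨h.1, Finset.mem_of_mem_erase h.2.1, Finset.mem_of_mem_erase h.2.2⟩
    have hcard := ih _ (Finset.erase_ssubset hv) (hG.anti hle)
    have hsub : ∃ e, G.edgesWithin Q ⊆ insert e (G.edgesWithin (Q.erase v)) := by
      by_cases hex : ∃ u ∈ Q, G.Adj v u
      · obtain ⟨u, hu, hvu⟩ := hex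
        have huniq : ∀ w ∈ Q, G.Adj v w → w = u := fun w hw hvw =>
          hleaf w hw u hu ⟨hvw, hv, hw⟩ ⟨hvu, hv, hu⟩
        refine ⟨s(v, u), fun e => ?_⟩
        induction e with
        | _ x y =>
          rw [Finset.mem_insert, mk_mem_edgesWithin, mk_mem_edgesWithin]
          rintro ⟨hxy, hx, hy⟩
          by_cases hxv : x = v
          · subst hxv
            exact .inl (by rw [huniq y hy hxy])
          by_cases hyv : y = v
          · subst hyv
            exact .inl (by rw [huniq x hx hxy.symm, Sym2.eq_swap])
          exact .inr ⟨hxy, by simp [hxv, hx], by simp [hyv, hy]⟩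
      · push Not at hex
        refine ⟨s(v, v), fun e => ?_⟩
        induction e with
        | _ x y =>
          rw [Finset.mem_insert, mk_mem_edgesWithin, mk_mem_edgesWithin]
          rintro ⟨hxy, hx, hy⟩
          refine .inr ⟨hxy, ?_, ?_⟩
          · simpa [hx] using fun h : x = v => hex y hy (h ▸ hxy)
          · simpa [hy] using fun h : y = v => hex x hx (h ▸ hxy.symm)
    obtain ⟨e, he⟩ := hsub
    have h1 := (Finset.card_le_card he).trans (Finset.card_insert_le _ _)
    have h2 := Finset.card_erase_add_one hv
    omega

theorem restrictTo_isAcyclic_of_card_lt_egirth {G : SimpleGraph V} (S : Finset V)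
    (h : (S.card : ℕ∞) < G.egirth) : (G.restrictTo S).IsAcyclic := by
  classical
  intro x c hc
  -- The tail is used because the start of a trivial walk need not lie in `S`; for a cycle it lists
  -- every vertex exactly once.
  have hmem : ∀ {u w} (p : (G.restrictTo (S : Set V)).Walk u w), ∀ y ∈ p.support.tail, y ∈ S := by
    intro u w p
    induction p with
    | nil => simp
    | @cons u v w huv p ih =>
      intro y hy
      rw [Walk.support_cons, List.tail_cons, Walk.mem_support_iff] at hy
      rcases hy with rfl | hy
      · exact huv.2.2
      · exact ih y hy
  have hlen : c.length ≤ S.card := by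
    have h1 : c.support.tail.toFinset ⊆ S := fun y hy => hmem c y (List.mem_toFinset.1 hy)
    have h2 := Finset.card_le_card h1
    rw [List.toFinset_card_of_nodup hc.support_nodup] at h2
    simpa using h2
  have h3 : G.egirth ≤ c.length := by
    simpa using egirth_le_length (hc.mapLe (G.restrictTo_le S))
  exact absurd (h3.trans (Nat.cast_le.2 hlen)) (not_le.2 h)

/-! ### Sets that contain all short paths between their vertices -/

/-- Every path of `G` of length less than `n` between vertices of `S` stays inside `S`. -/
def IsPathClosed (G : SimpleGraph V) (n : ℕ) (S : Set V) : Prop :=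
  ∀ u ∈ S, ∀ w ∈ S, ∀ p : G.Walk u w, p.IsPath → p.length < n → ∀ x ∈ p.support, x ∈ S

/-- The smallest set containing `P` that contains all paths of length less than `n` between its
vertices. -/
def pathClosure (G : SimpleGraph V) (n : ℕ) (P : Set V) : Set V :=
  ⋂₀ {S | P ⊆ S ∧ G.IsPathClosed n S}

variable {G : SimpleGraph V} {n : ℕ}

theorem subset_pathClosure (P : Set V) : P ⊆ G.pathClosure n P :=
  Set.subset_sInter fun _ hS => hS.1

theorem pathClosure_subset {P S : Set V} (hP : P ⊆ S) (hS : G.IsPathClosed n S) :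
    G.pathClosure n P ⊆ S :=
  Set.sInter_subset_of_mem ⟨hP, hS⟩

theorem isPathClosed_pathClosure (P : Set V) : G.IsPathClosed n (G.pathClosure n P) :=
  fun u hu w hw p hp hn x hx S hS => hS.2 u (hu S hS) w (hw S hS) p hp hn x hx

theorem pathClosure_mono {P P' : Set V} (h : P ⊆ P') : G.pathClosure n P ⊆ G.pathClosure n P' :=
  pathClosure_subset (h.trans (subset_pathClosure P')) (isPathClosed_pathClosure P')

theorem pathClosure_empty : G.pathClosure n ∅ = ∅ :=
  Set.subset_empty_iff.1 (pathClosure_subset subset_rfl fun _ h => h.elim)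

/-- A walk ending in `S` has at least as many edges leaving `S` as vertices outside `S`, and more
if it also starts in `S` and is not contained in `S`. -/
theorem Walk.length_filter_support_le [DecidableEq V] (S : Finset V) {u w : V} (p : G.Walk u w)
    (hw : w ∈ S) :
    (p.support.filter (· ∉ S)).length ≤ (p.edges.filter (· ∉ S.sym2)).length ∧
      (u ∈ S → (∃ x ∈ p.support, x ∉ S) →
        (p.support.filter (· ∉ S)).length < (p.edges.filter (· ∉ S.sym2)).length) := by
  -- Each vertex outside `S` is charged to the edge by which the walk leaves it. An edge stepping
  -- from `S` to the outside is charged by nobody, which gives the strict inequality.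
  induction p with
  | nil => simp [hw]
  | @cons u v w huv p ih =>
    obtain ⟨ih1, ih2⟩ := ih hw
    rw [Walk.support_cons, Walk.edges_cons]
    by_cases hu : u ∈ S
    · by_cases hv : v ∈ S
      · rw [List.filter_cons_of_neg (by simpa using hu),
          List.filter_cons_of_neg (by simpa using ⟨hu, hv⟩)]
        refine ⟨ih1, fun _ ⟨x, hx, hxS⟩ => ih2 hv ⟨x, ?_, hxS⟩⟩
        rcases List.mem_cons.1 hx with rfl | hx
        · exact absurd hu hxS
        · exact hx
      · rw [List.filter_cons_of_neg (by simpa using hu),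
          List.filter_cons_of_pos (by simpa using .inr hv), List.length_cons]
        exact ⟨by omega, fun _ _ => by omega⟩
    · rw [List.filter_cons_of_pos (by simpa using hu),
        List.filter_cons_of_pos (by simpa using .inl hu), List.length_cons,
        List.length_cons]
      exact ⟨by omega, fun h => absurd h hu⟩

/-- Adding to `S` a short path between vertices of `S` increases the number of edges inside by more
than the number of vertices. -/
theorem exists_enlargement_of_not_isPathClosed [Fintype V] (S : Finset V)
    (hS : ¬ G.IsPathClosed n S) :
    ∃ T : Finset V, S ⊆ T ∧ (∀ C : Set V, ↑S ⊆ C → G.IsPathClosed n C → ↑T ⊆ C) ∧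
      T.card ≤ S.card + (n - 2) ∧
      T.card + 1 + (G.edgesWithin S).card ≤ S.card + (G.edgesWithin T).card := by
  classical
  simp only [IsPathClosed, not_forall] at hS
  obtain ⟨u, hu, w, hw, p, hp, hn, x, hx, hxS⟩ := hS
  rw [Finset.mem_coe] at hu hw hxS
  have huw : u ≠ w := by
    rintro rfl
    rw [Walk.isPath_iff_nil.1 hp |>.eq_nil] at hx
    simp only [Walk.support_nil, List.mem_singleton] at hx
    exact hxS (hx ▸ hu)
  set N := (p.support.filter (· ∉ S)).toFinset with hN
  set E := (p.edges.filter (· ∉ S.sym2)).toFinset with hE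
  have hcount := (p.length_filter_support_le S hw).2 hu ⟨x, hx, hxS⟩
  rw [← List.toFinset_card_of_nodup (hp.support_nodup.filter _), ← hN,
    ← List.toFinset_card_of_nodup (hp.isTrail.edges_nodup.filter _), ← hE] at hcount
  have hdisj : Disjoint S N := by
    rw [Finset.disjoint_left]
    intro y hy hyN
    simp [hN] at hyN
    exact hyN.2 hy
  refine ⟨S ∪ N, Finset.subset_union_left, ?_, ?_, ?_⟩
  · intro C hSC hC y hy
    rcases Finset.mem_union.1 (Finset.mem_coe.1 hy) with hy | hy
    · exact hSC hy
    · simp [hN] at hy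
      exact hC u (hSC hu) w (hSC hw) p hp hn y hy.1
  · rw [Finset.card_union_of_disjoint hdisj]
    -- A path with fewer than `n` edges has at most `n` vertices, and its two distinct ends are
    -- already in `S`; hence at most `n - 2` new ones.
    have hsub : insert u (insert w N) ⊆ p.support.toFinset := by
      intro y hy
      simp only [Finset.mem_insert, hN, List.mem_toFinset, List.mem_filter] at hy ⊢
      rcases hy with rfl | rfl | hy
      · simp
      · simp
      · exact hy.1
    have hcard := Finset.card_le_card hsub
    rw [Finset.card_insert_of_notMem, Finset.card_insert_of_notMem,
      List.toFinset_card_of_nodup hp.support_nodup, Walk.length_support] at hcard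
    · omega
    · exact Finset.disjoint_left.1 hdisj hw
    · simp only [Finset.mem_insert, huw, false_or]
      exact Finset.disjoint_left.1 hdisj hu
  · rw [Finset.card_union_of_disjoint hdisj]
    have hdisjE : Disjoint (G.edgesWithin S) E := by
      rw [Finset.disjoint_left]
      intro e he heE
      simp only [hE, List.mem_toFinset, List.mem_filter, decide_eq_true_eq] at heE
      simp only [edgesWithin, Finset.mem_inter] at he
      exact heE.2 he.2
    have hsub : G.edgesWithin S ∪ E ⊆ G.edgesWithin (S ∪ N) := by
      intro e he
      induction e with
      | _ y z =>
        rw [mk_mem_edgesWithin]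
        rcases Finset.mem_union.1 he with he | he
        · rw [mk_mem_edgesWithin] at he
          exact ⟨he.1, Finset.mem_union_left _ he.2.1, Finset.mem_union_left _ he.2.2⟩
        · simp only [hE, List.mem_toFinset, List.mem_filter] at he
          have hmem : ∀ t ∈ p.support, t ∈ S ∪ N := fun t ht => by
            simp only [hN, Finset.mem_union, List.mem_toFinset, List.mem_filter, ht, true_and,
              decide_eq_true_eq]
            exact em _
          exact ⟨p.adj_of_mem_edges he.1, hmem _ (p.fst_mem_support_of_mem_edges he.1),
            hmem _ (p.snd_mem_support_of_mem_edges he.1)⟩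
    have hcard := Finset.card_le_card hsub
    rw [Finset.card_union_of_disjoint hdisjE] at hcard
    omega

/-- In a graph of large girth, the closure of a small set of vertices spans a forest. -/
theorem restrictTo_pathClosure_isAcyclic [Fintype V] {k : ℕ} {P : Finset V} (hP : P.card ≤ k)
    (hg : ((k + (k + 1) * (n - 2) : ℕ) : ℕ∞) < G.egirth) :
    (G.restrictTo (G.pathClosure n P)).IsAcyclic := by
  classical
  have hacyc : ∀ S : Finset V, S.card ≤ k + (k + 1) * (n - 2) → (G.restrictTo S).IsAcyclic :=
    fun S hS => restrictTo_isAcyclic_of_card_lt_egirth S ((Nat.cast_le.2 hS).trans_lt hg)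
  -- After `j` enlargements the number of edges minus the number of vertices is at least `j - k`. At
  -- `j = k + 1` this contradicts the forest bound, so the process closes earlier.
  have key : ∀ j ≤ k + 1, (G.restrictTo (G.pathClosure n P)).IsAcyclic ∨
      ∃ S : Finset V, P ⊆ S ∧ (S : Set V) ⊆ G.pathClosure n P ∧ S.card ≤ k + j * (n - 2) ∧
        S.card + j ≤ (G.edgesWithin S).card + k := by
    intro j
    induction j with
    | zero => exact fun _ => .inr ⟨P, subset_rfl, subset_pathClosure _, by omega, by omega⟩
    | succ j ih =>
      intro hj
      rcases ih (by omega) with h | ⟨S, hPS, hScl, hcard, hedge⟩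
      · exact .inl h
      have hj' : j * (n - 2) ≤ (k + 1) * (n - 2) := Nat.mul_le_mul_right _ (by omega)
      by_cases hS : G.IsPathClosed n S
      · left
        rw [Set.Subset.antisymm (pathClosure_subset (by exact_mod_cast hPS) hS) hScl]
        exact hacyc S (by omega)
      · obtain ⟨T, hST, hT, hTcard, hTedge⟩ := exists_enlargement_of_not_isPathClosed S hS
        exact .inr ⟨T, hPS.trans hST, hT _ hScl (isPathClosed_pathClosure _),
          by rw [Nat.succ_mul]; omega, by omega⟩
  rcases key (k + 1) le_rfl with h | ⟨S, -, -, hcard, hedge⟩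
  · exact h
  · have := card_edgesWithin_le_of_isAcyclic S (hacyc S hcard)
    omega

end SimpleGraph

/-! ### Extending solutions along forests -/

theorem F2Vec.add_self {m : ℕ} (x : F2Vec m) : x + x = 0 :=
  funext fun i => CharTwo.add_self_eq_zero (x i)

theorem F2Vec.sub_eq_add {m : ℕ} (x y : F2Vec m) : x - y = x + y := by
  rw [sub_eq_iff_eq_add, add_assoc, F2Vec.add_self, add_zero]

section Extension

variable {V : Type u} {m : ℕ}

/-- The shift `h` of the variables respects the constraints of the edges of `G`. -/
def IsShiftOn (G : SimpleGraph V) (Z : Sym2 V → Submodule (ZMod 2) (F2Vec m))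
    (b : Sym2 V → F2Vec m) (h : V → F2Vec m) : Prop :=
  ∀ x y, G.Adj x y → h x + h y + b s(x, y) ∈ Z s(x, y)

/-- In a forest, every vertex `v` may be required to lie in a coset `c v + W v`, provided that
these requirements are far apart: `a v` is the distance of `v` to the source of its requirement,
and a path that leads from `v` to distance `r` from that source spans everything. -/
theorem exists_shift_of_coset_requirements [Finite V] {G : SimpleGraph V} (hG : G.IsAcyclic)
    (Z : Sym2 V → Submodule (ZMod 2) (F2Vec m)) (b : Sym2 V → F2Vec m) (r : ℕ) (Q : Finset V)
    (a : V → ℕ) (c : V → F2Vec m) (W : V → Submodule (ZMod 2) (F2Vec m))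
    (hfar : ∀ u v, u ≠ v → ∀ p : G.Walk u v, p.IsPath → (∀ x ∈ p.support, x ∈ Q) →
      2 * r ≤ a u + p.length + a v)
    (hspan : ∀ u v, ∀ p : G.Walk u v, p.IsPath → (∀ x ∈ p.support, x ∈ Q) →
      r ≤ a u + p.length → W u ⊔ ⨆ e ∈ p.edges, Z e = ⊤) :
    ∃ h : V → F2Vec m, (∀ v ∈ Q, h v - c v ∈ W v) ∧
      ∀ x ∈ Q, ∀ y ∈ Q, G.Adj x y → h x + h y + b s(x, y) ∈ Z s(x, y) := by
  classical
  induction Q using Finset.strongInduction generalizing a c W with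
  | H Q ih =>
    rcases Q.eq_empty_or_nonempty with rfl | hQ
    · exact ⟨fun _ => 0, by simp, by simp⟩
    obtain ⟨v, hv, hleaf⟩ := hG.exists_mem_subsingleton_neighbors hQ
    have hss := Finset.erase_ssubset hv
    have hQ' : ∀ {x}, x ∈ Q.erase v → x ∈ Q := Finset.mem_of_mem_erase
    by_cases hex : ∃ u ∈ Q, G.Adj v u
    · obtain ⟨u, hu, hvu⟩ := hex
      have huniq : ∀ w ∈ Q, G.Adj v w → w = u := fun w hw hvw => hleaf w hw u hu hvw hvu
      have hu' : u ∈ Q.erase v := Finset.mem_erase.2 ⟨hvu.ne', hu⟩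
      have hcons : ∀ {x} (p : G.Walk u x), p.IsPath → (∀ y ∈ p.support, y ∈ Q.erase v) →
          (SimpleGraph.Walk.cons hvu p).IsPath ∧
            ∀ y ∈ (SimpleGraph.Walk.cons hvu p).support, y ∈ Q := by
        intro x p hp hpQ
        refine ⟨hp.cons fun hvp => by simpa using hpQ v hvp, fun y hy => ?_⟩
        rw [SimpleGraph.Walk.support_cons] at hy
        rcases List.mem_cons.1 hy with rfl | hy
        · exact hv
        · exact hQ' (hpQ y hy)
      have hedge : 2 * r ≤ a v + 1 + a u := by
        have := hcons (.nil : G.Walk u u) (by simp) (by simpa using And.intro hvu.ne' hu)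
        simpa using hfar v u hvu.ne _ this.1 this.2
      -- The leaf `v` is valued last: a splitting `w + z` of the displayed difference, with `w ∈ W
      -- v` and `z ∈ Z s(v, u)`, allows the value `c v + w` at `v`. The demand at `v` thus becomes a
      -- coset demand at `u`.
      suffices hsuff : ∃ h : V → F2Vec m, h u - (c v + b s(v, u)) ∈ W v ⊔ Z s(v, u) ∧
          (∀ x ∈ Q.erase v, h x - c x ∈ W x) ∧
          ∀ x ∈ Q.erase v, ∀ y ∈ Q.erase v, G.Adj x y →
            h x + h y + b s(x, y) ∈ Z s(x, y) by
        obtain ⟨h, hhu, hhW, hhE⟩ := hsuff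
        obtain ⟨w, hw, z, hz, hwz⟩ := Submodule.mem_sup.1 hhu
        have hhu' : h u + (c v + w) + b s(v, u) = z := by
          have e : h u = w + z + (c v + b s(v, u)) := by rw [hwz]; abel
          calc h u + (c v + w) + b s(v, u)
              = z + (w + w) + (c v + c v) + (b s(v, u) + b s(v, u)) := by rw [e]; abel
            _ = z := by simp only [F2Vec.add_self, add_zero]
        refine ⟨Function.update h v (c v + w), fun x hx => ?_, fun x hx y hy hxy => ?_⟩
        · by_cases hxv : x = v
          · subst hxv; simpa using hw
          · simpa [hxv] using hhW x (Finset.mem_erase.2 ⟨hxv, hx⟩)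
        · by_cases hxv : x = v
          · subst hxv
            obtain rfl := huniq y hy hxy
            rw [Function.update_self, Function.update_of_ne hxy.ne', add_comm (c x + w), hhu']
            exact hz
          by_cases hyv : y = v
          · subst hyv
            obtain rfl := huniq x hx hxy.symm
            rw [Function.update_self, Function.update_of_ne hxy.ne, Sym2.eq_swap, hhu']
            exact hz
          · rw [Function.update_of_ne hxv, Function.update_of_ne hyv]
            exact hhE x (Finset.mem_erase.2 ⟨hxv, hx⟩) y (Finset.mem_erase.2 ⟨hyv, hy⟩) hxy
      -- By `hedge`, the farther of the two sources competing at `u` is at distance at least `r`, so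
      -- its demand is void. Here that is the old demand at `u`, and the one coming from `v`
      -- replaces it.
      by_cases hva : a v + 1 ≤ a u
      · have hWu : W u = ⊤ := by
          simpa using hspan u u .nil (by simp) (by simpa using hu) (by simp; omega)
        refine Exists.elim (ih _ hss (Function.update a u (a v + 1))
          (Function.update c u (c v + b s(v, u)))
          (Function.update W u (W v ⊔ Z s(v, u))) ?_ ?_) ?_
        · intro x y hxy p hp hpQ
          by_cases hxu : x = u
          · subst hxu
            have h1 := hcons p hp hpQ
            have hyv : v ≠ y := by
              rintro rfl
              simpa using hpQ _ p.end_mem_support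
            have := hfar v y hyv _ h1.1 h1.2
            simp [hxy.symm] at this ⊢
            omega
          by_cases hyu : y = u
          · subst hyu
            have h1 := hcons p.reverse hp.reverse (by simpa using hpQ)
            have hxv : v ≠ x := by
              rintro rfl
              simpa using hpQ _ p.start_mem_support
            have := hfar v x hxv _ h1.1 h1.2
            simp [hxu] at this ⊢
            omega
          · simpa [hxu, hyu] using hfar x y hxy p hp fun t ht => hQ' (hpQ t ht)
        · intro x y p hp hpQ hr
          by_cases hxu : x = u
          · subst hxu
            have h1 := hcons p hp hpQ
            have := hspan v y _ h1.1 h1.2 (by simp at hr ⊢; omega)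
            rw [SimpleGraph.Walk.edges_cons] at this
            simpa [iSup_or, iSup_sup_eq, sup_assoc] using this
          · simp only [Function.update_of_ne hxu] at hr ⊢
            exact hspan x y p hp (fun t ht => hQ' (hpQ t ht)) hr
        · rintro h ⟨hhW, hhE⟩
          refine ⟨h, by simpa using hhW u hu', fun x hx => ?_, hhE⟩
          by_cases hxu : x = u
          · subst hxu; simp [hWu]
          · simpa [hxu] using hhW x hx
      -- Now the demand passed on by `v` is void, so `u` keeps its own.
      · have htop : W v ⊔ Z s(v, u) = ⊤ := by
          have h1 := hcons (.nil : G.Walk u u) (by simp) (by simpa using And.intro hvu.ne' hu)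
          simpa using hspan v u _ h1.1 h1.2 (by simp; omega)
        obtain ⟨h, hhW, hhE⟩ := ih _ hss a c W
          (fun x y hxy p hp hpQ => hfar x y hxy p hp fun t ht => hQ' (hpQ t ht))
          (fun x y p hp hpQ => hspan x y p hp fun t ht => hQ' (hpQ t ht))
        exact ⟨h, by rw [htop]; trivial, hhW, hhE⟩
    · push Not at hex
      obtain ⟨h, hhW, hhE⟩ := ih _ hss a c W
        (fun x y hxy p hp hpQ => hfar x y hxy p hp fun t ht => hQ' (hpQ t ht))
        (fun x y p hp hpQ => hspan x y p hp fun t ht => hQ' (hpQ t ht))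
      refine ⟨Function.update h v (c v), fun x hx => ?_, fun x hx y hy hxy => ?_⟩
      · by_cases hxv : x = v
        · subst hxv; simp
        · simpa [hxv] using hhW x (Finset.mem_erase.2 ⟨hxv, hx⟩)
      · have hxv : x ≠ v := by rintro rfl; exact hex y hy hxy
        have hyv : y ≠ v := by rintro rfl; exact hex x hx hxy.symm
        rw [Function.update_of_ne hxv, Function.update_of_ne hyv]
        exact hhE x (Finset.mem_erase.2 ⟨hxv, hx⟩) y (Finset.mem_erase.2 ⟨hyv, hy⟩) hxy

/-- A shift that respects the constraints inside a set `S` containing all paths of length less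
than `2 * r` between its vertices extends to every larger set that spans a forest. -/
theorem exists_shift_extension [Finite V] {H : SimpleGraph V}
    {Z : Sym2 V → Submodule (ZMod 2) (F2Vec m)} {b : Sym2 V → F2Vec m} {r : ℕ} {S T : Set V}
    (hS : H.IsPathClosed (2 * r) S) (hT : (H.restrictTo T).IsAcyclic)
    (hspan : ∀ u v, ∀ p : H.Walk u v, p.IsPath → r ≤ p.length → ⨆ e ∈ p.edges, Z e = ⊤)
    {g : V → F2Vec m} (hg : IsShiftOn (H.restrictTo S) Z b g) :
    ∃ h : V → F2Vec m, (∀ v ∈ S, h v = g v) ∧ IsShiftOn (H.restrictTo T) Z b h := by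
  classical
  have := Fintype.ofFinite V
  -- Edges inside `S` are already satisfied and are removed. Vertices of `S` get exact values (`⊥`,
  -- distance 0); the others are free, and distance `2 * r` makes the conditions on them trivial.
  set G : SimpleGraph V := H.restrictTo T \ H.restrictTo S with hGdef
  have hGH : G ≤ H := sdiff_le.trans (H.restrictTo_le T)
  refine Exists.elim (exists_shift_of_coset_requirements (hT.anti sdiff_le : G.IsAcyclic) Z b r
    Finset.univ (fun v => if v ∈ S then 0 else 2 * r) g
    (fun v => if v ∈ S then ⊥ else ⊤) ?_ ?_) ?_
  · intro u v huv p hp _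
    by_cases hu : u ∈ S
    · by_cases hv : v ∈ S
      · simp only [hu, hv, if_true, zero_add, add_zero]
        -- A shorter path would stay in `S`, but then its first edge was removed.
        by_contra hlt
        have hmem := hS u hu v hv (p.mapLe hGH) (hp.mapLe hGH) (by simpa using hlt)
        simp only [SimpleGraph.Walk.support_mapLe_eq_support] at hmem
        cases p with
        | nil => exact huv rfl
        | cons hux p =>
          exact hux.2 ⟨hux.1.1, hu, hmem _ (by simp)⟩
      · simp [hv]
    · simp only [hu, if_false]
      omega
  · intro u v p hp _ hr
    by_cases hu : u ∈ S
    · simp only [hu, if_true, zero_add, bot_sup_eq] at hr ⊢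
      simpa using hspan u v (p.mapLe hGH) (hp.mapLe hGH) (by simpa using hr)
    · simp [hu]
  · rintro h ⟨hhW, hhE⟩
    have hhS : ∀ v ∈ S, h v = g v := fun v hv => by
      simpa [hv, sub_eq_zero] using hhW v (Finset.mem_univ v)
    refine ⟨h, hhS, fun x y hxy => ?_⟩
    by_cases hxyS : (H.restrictTo S).Adj x y
    · rw [hhS x hxyS.2.1, hhS y hxyS.2.2]
      exact hg x y hxyS
    · exact hhE x (Finset.mem_univ x) y (Finset.mem_univ y) ⟨hxy, hxyS⟩

end Extension

/-! ### Duplicator's strategy -/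

section Strategy

variable {V : Type u} {m : ℕ}

/-- The variables on whose copies the pebbles lie. -/
def pebbledVars {k : ℕ} (p : PebblePosition k (V × F2Vec m) (V × F2Vec m)) : Set V :=
  {x | ∃ i g y, p i = some ((x, g), y)}

/-- The pebbles map `x^g` to `x^(g + h x)`. -/
def FollowsShift {k : ℕ} (p : PebblePosition k (V × F2Vec m) (V × F2Vec m)) (h : V → F2Vec m) :
    Prop :=
  ∀ i x y, p i = some (x, y) → y = (x.1, x.2 + h x.1)

theorem isPartialIsoAt_of_followsShift {k : ℕ} {H : SimpleGraph V}
    {Z : Sym2 V → Submodule (ZMod 2) (F2Vec m)} {b : Sym2 V → F2Vec m}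
    {p : PebblePosition k (V × F2Vec m) (V × F2Vec m)} {h : V → F2Vec m} (hp : FollowsShift p h)
    (hh : IsShiftOn (H.restrictTo (pebbledVars p)) Z b h) :
    IsPartialIsoAt (linearInstance H Z).labelLift.toStructure
      (shiftedInstance H Z b).labelLift.toStructure p := by
  refine ⟨fun i j x x' y y' hi hj => ?_, fun n R t x y hxy => ?_⟩
  · rw [hp i x y hi, hp j x' y' hj]
    refine ⟨fun e => by rw [e], fun e => ?_⟩
    obtain ⟨e1, e2⟩ := Prod.mk.inj e
    rw [e1] at e2
    exact Prod.ext e1 (add_right_cancel e2)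
  · obtain ⟨π⟩ := R
    have hx : ∀ j, (x j).1 ∈ pebbledVars p := fun j => ⟨t j, (x j).2, y j, hxy j⟩
    have hy : ∀ j, y j = ((x j).1, (x j).2 + h (x j).1) := fun j => hp _ _ _ (hxy j)
    change (∃ z, (∃ z₀, (H.Adj (x 1).1 (x 0).1 ∧ ∃ z' ∈ Z s((x 1).1, (x 0).1), z₀ = z') ∧
        z = z₀ + (x 1).2 - (x 0).2) ∧ ∀ a, π a = z + a) ↔
      (∃ z, (∃ z₀, (H.Adj (y 1).1 (y 0).1 ∧ ∃ z' ∈ Z s((y 1).1, (y 0).1),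
        z₀ = z' + b s((y 1).1, (y 0).1)) ∧ z = z₀ + (y 1).2 - (y 0).2) ∧ ∀ a, π a = z + a)
    rw [hy 0, hy 1]
    generalize hs0 : x 0 = s
    generalize hs1 : x 1 = s'
    obtain ⟨x₀, g₀⟩ := s
    obtain ⟨x₁, g₁⟩ := s'
    have hmem : ∀ e : H.Adj x₁ x₀, h x₁ + h x₀ + b s(x₁, x₀) ∈ Z s(x₁, x₀) := fun e =>
      hh x₁ x₀ ⟨e, by simpa [hs1] using hx 1, by simpa [hs0] using hx 0⟩
    constructor
    · rintro ⟨_, ⟨z₀, ⟨hadj, _, hz₀, rfl⟩, rfl⟩, hπ⟩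
      -- The translation absorbs both the shift and `b` into `Z`; in characteristic 2 the sign of `h
      -- x₀` is immaterial.
      refine ⟨_, ⟨_, ⟨hadj, z₀ - (h x₁ + h x₀ + b s(x₁, x₀)), sub_mem hz₀ (hmem hadj), rfl⟩, rfl⟩,
        fun a => ?_⟩
      rw [hπ a]
      calc z₀ + g₁ - g₀ + a = z₀ + g₁ - g₀ + a - (h x₀ + h x₀) := by
            rw [F2Vec.add_self, sub_zero]
        _ = _ := by simp only; abel
    · rintro ⟨_, ⟨_, ⟨hadj, z₀, hz₀, rfl⟩, rfl⟩, hπ⟩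
      refine ⟨_, ⟨_, ⟨hadj, z₀ + (h x₁ + h x₀ + b s(x₁, x₀)), add_mem hz₀ (hmem hadj), rfl⟩, rfl⟩,
        fun a => ?_⟩
      rw [hπ a]
      calc _ = z₀ + b s(x₁, x₀) + (g₁ + h x₁) - (g₀ + h x₀) + a + (h x₀ + h x₀) := by
            rw [F2Vec.add_self, add_zero]
        _ = _ := by simp only; abel

theorem duplicatorWins_of_spanning_paths [Fintype V] {H : SimpleGraph V}
    {Z : Sym2 V → Submodule (ZMod 2) (F2Vec m)} {b : Sym2 V → F2Vec m} {k r : ℕ} (hr : 0 < r)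
    (hg : (((k + 1) ^ 2 * r : ℕ) : ℕ∞) ≤ H.egirth)
    (hspan : ∀ u v, ∀ p : H.Walk u v, p.IsPath → r ≤ p.length → ⨆ e ∈ p.edges, Z e = ⊤) :
    DuplicatorWins k (linearInstance H Z).labelLift.toStructure
      (shiftedInstance H Z b).labelLift.toStructure := by
  classical
  have hmono : ∀ {S T : Set V}, S ⊆ T → ∀ {h : V → F2Vec m},
      IsShiftOn (H.restrictTo T) Z b h → IsShiftOn (H.restrictTo S) Z b h :=
    fun hST _ hh x y hxy => hh x y ⟨hxy.1, hST hxy.2.1, hST hxy.2.2⟩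
  refine ⟨{p | ∃ h, FollowsShift p h ∧
    IsShiftOn (H.restrictTo (H.pathClosure (2 * r) (pebbledVars p))) Z b h}, ?_, ?_⟩
  · refine ⟨fun _ => 0, fun i x y h => by simp at h, fun x y hxy => ?_⟩
    have : pebbledVars (fun _ => none : PebblePosition k (V × F2Vec m) (V × F2Vec m)) = ∅ := by
      ext; simp [pebbledVars]
    rw [this, SimpleGraph.pathClosure_empty] at hxy
    exact hxy.2.1.elim
  rintro p ⟨h, hp, hh⟩
  refine ⟨isPartialIsoAt_of_followsShift hp (hmono (SimpleGraph.subset_pathClosure _) hh),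
    fun i => ?_⟩
  -- The variables of the pebbles that remain; `h` is forgotten outside their closure.
  set P : Set V := {x | ∃ j, j ≠ i ∧ ∃ g y, p j = some ((x, g), y)} with hPdef
  have hPp : P ⊆ pebbledVars p := fun x ⟨j, _, hj⟩ => ⟨j, hj⟩
  have hPcard : P.toFinset.card + 1 ≤ k := by
    have hsub : P.toFinset.image some ⊆
        (Finset.univ.erase i).image fun j => (p j).map fun q => q.1.1 := by
      intro x hx
      simp only [Finset.mem_image, Set.mem_toFinset] at hx
      obtain ⟨x, ⟨j, hj, g, y, hpj⟩, rfl⟩ := hx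
      exact Finset.mem_image.2 ⟨j, by simpa using hj, by simp [hpj]⟩
    have h1 := (Finset.card_le_card hsub).trans Finset.card_image_le
    rw [Finset.card_image_of_injective _ (Option.some_injective _),
      Finset.card_erase_of_mem (Finset.mem_univ i), Finset.card_univ, Fintype.card_fin] at h1
    have := i.pos
    omega
  have hext : ∀ x : V, ∃ h' : V → F2Vec m, (∀ v ∈ P, h' v = h v) ∧
      IsShiftOn (H.restrictTo (H.pathClosure (2 * r) (insert x P))) Z b h' := by
    intro x
    have hcard : (insert x P.toFinset).card ≤ k := (Finset.card_insert_le _ _).trans hPcard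
    -- The lifted pebble `i` forces `k ≥ 1`, without which this can fail.
    have hlt : k + (k + 1) * (2 * r - 2) < (k + 1) ^ 2 * r := by
      obtain ⟨k, rfl⟩ : ∃ k', k = k' + 1 := ⟨k - 1, by omega⟩
      obtain ⟨r, rfl⟩ : ∃ r', r = r' + 1 := ⟨r - 1, by omega⟩
      rw [show 2 * (r + 1) - 2 = 2 * r by omega]
      nlinarith [Nat.zero_le (k * r), Nat.zero_le (k * k * r), Nat.zero_le (k * k)]
    have hforest := SimpleGraph.restrictTo_pathClosure_isAcyclic (G := H) (n := 2 * r) hcard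
      ((Nat.cast_lt.2 hlt).trans_le hg)
    rw [Finset.coe_insert, Set.coe_toFinset] at hforest
    obtain ⟨h', hh', hh'T⟩ := exists_shift_extension
      (SimpleGraph.isPathClosed_pathClosure (G := H) (n := 2 * r) P) hforest hspan
      (hmono (SimpleGraph.pathClosure_mono hPp) hh)
    exact ⟨h', fun v hv => hh' v (SimpleGraph.subset_pathClosure P hv), hh'T⟩
  choose h' hh'P hh' using hext
  have hfollow : ∀ {j x y}, j ≠ i → p j = some (x, y) → ∀ x', y = (x.1, x.2 + h' x' x.1) := by
    intro j x y hj hpj x'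
    rw [hp j x y hpj, hh'P x' x.1 ⟨j, hj, x.2, y, hpj⟩]
  -- The extension depends on the vertex `x` to be pebbled, so each fibre is translated by its own
  -- `h' x x`. All extensions agree with `h` on `P`, hence with the remaining pebbles.
  refine ⟨Equiv.prodShear (Equiv.refl V) fun x => Equiv.addRight (h' x x), ?_, ?_⟩
  · intro j x y hj hpj
    exact (hfollow hj hpj x.1).symm
  · rintro ⟨x, g⟩
    refine ⟨h' x, ?_, hmono (SimpleGraph.pathClosure_mono ?_) (hh' x)⟩
    · intro j y z hj
      by_cases hji : j = i
      · subst hji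
        rw [Function.update_self] at hj
        obtain ⟨rfl, rfl⟩ := Prod.mk.inj (Option.some.inj hj)
        rfl
      · rw [Function.update_of_ne hji] at hj
        exact hfollow hji hj x
    · rintro y ⟨j, g', z, hj⟩
      by_cases hji : j = i
      · subst hji
        rw [Function.update_self] at hj
        exact .inl (Prod.mk.inj (Prod.mk.inj (Option.some.inj hj)).1).1.symm
      · rw [Function.update_of_ne hji] at hj
        exact .inr ⟨j, hji, g', z, hj⟩

/-! ### Long paths of good edges -/

theorem goodGraph_le (H : SimpleGraph V) (r : ℕ) (Z : Sym2 V → Submodule (ZMod 2) (F2Vec m)) :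
    goodGraph H r Z ≤ H := fun _ _ h => ((SimpleGraph.fromEdgeSet_adj _).1 h).1.1

/-- The first `r` edges form a trail of `H` that begins with a good edge, so they already span. -/
theorem goodGraph_iSup_edges_eq_top {H : SimpleGraph V} {r : ℕ} (hr : 0 < r)
    {Z : Sym2 V → Submodule (ZMod 2) (F2Vec m)} {u v : V} (p : (goodGraph H r Z).Walk u v)
    (hp : p.IsPath) (hlen : r ≤ p.length) : ⨆ e ∈ p.edges, Z e = ⊤ := by
  cases p with
  | nil => simp at hlen; omega
  | @cons _ x _ hux q =>
    set p := SimpleGraph.Walk.cons hux q with hpdef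
    have hgood := ((SimpleGraph.fromEdgeSet_adj _).1 hux).1.2 _ _
      ((p.take r).mapLe (goodGraph_le H r Z)) ((hp.take r).mapLe _).isTrail
      (by simpa using hlen) (by
        obtain ⟨r, rfl⟩ : ∃ r', r = r' + 1 := ⟨r - 1, by omega⟩
        rw [SimpleGraph.Walk.edges_mapLe_eq_edges, SimpleGraph.Walk.edges_take, hpdef]
        simp)
    rw [eq_top_iff, ← hgood, Submodule.span_le]
    refine Set.iUnion₂_subset fun e he => ?_
    rw [SimpleGraph.Walk.edges_mapLe_eq_edges, SimpleGraph.Walk.edges_take] at he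
    exact le_iSup₂ (f := fun e (_ : e ∈ p.edges) => Z e) e (List.mem_of_mem_take he)

end Strategy

theorem mainTheorem3 (ε δ : ℝ) (hε₀ : 0 < ε) (hε : ε < 1 / 2) (hδ : 0 < δ)
    (ℓ : ℕ) (hℓ : 0 < ℓ) (k : ℕ)
    {V : Type u} [Fintype V] (Ht : SimpleGraph V) [DecidableRel Ht.Adj]
    (hreg : Ht.IsRegularOfDegree (degreeParam ℓ))
    (hgirth : (((k + 1) ^ 2 * radiusParam ε δ ℓ : ℕ) : ℕ∞) ≤ Ht.egirth)
    (b : Sym2 V → F2Vec (dimParam ε δ ℓ))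
    (Z : Sym2 V → Submodule (ZMod 2) (F2Vec (dimParam ε δ ℓ)))
    (hZ : ∀ e ∈ Ht.edgeSet, Module.finrank (ZMod 2) (Z e) = ℓ) :
    let H : SimpleGraph V := goodGraph Ht (radiusParam ε δ ℓ) Z
    let U₁ : GroupUniqueGame (F2Vec (dimParam ε δ ℓ)) V := linearInstance H Z
    let U₂ : GroupUniqueGame (F2Vec (dimParam ε δ ℓ)) V := shiftedInstance H Z b
    CkEquiv.{0, 0, w} k U₁.labelLift.toStructure U₂.labelLift.toStructure ∧
      DuplicatorWins k U₁.labelLift.toStructure U₂.labelLift.toStructure := by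
  intro H U₁ U₂
  have hr : 0 < radiusParam ε δ ℓ := Nat.succ_pos _
  have hwin : DuplicatorWins k U₁.labelLift.toStructure U₂.labelLift.toStructure :=
    duplicatorWins_of_spanning_paths hr
      (hgirth.trans (SimpleGraph.egirth_anti (goodGraph_le Ht _ Z)))
      fun _ _ p hp hlen => goodGraph_iSup_edges_eq_top hr p hp hlen
  exact ⟨hwin.ckEquiv, hwin⟩
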